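/- Let $K$ be a field, $n\ge 0$, $A=K[X_1,\dots,X_n]$, and let $I\subseteq A$ be an ideal that is homogeneous for the standard grading. For $\omega\in\mathbb R^n$ and $f\in A$, let $\mathrm{in}_\omega(f)$ be the sum of those terms $\alpha_a X^a$ of $f$ for which $\omega\cdot a$ is maximal (with $\mathrm{in}_\omega(0)=0$); for an ideal $J\subseteq A$, let $\mathrm{in}_\omega(J)$ be the ideal generated by all $\mathrm{in}_\omega(f)$, $f\in J$. Call $\omega,\omega'\in\mathbb R^n$ equivalent with respect to $J$ if $\mathrm{in}_\omega(J)=\mathrm{in}_{\omega'}(J)$. For a homogeneous ideal $J$, the Gröbner fan $\mathrm{Gf}(J)$ is the collection of the closures in $\mathbb R^n$ (Euclidean topology) of all equivalence classes. For $g=(g_{ij})\in \mathrm{GL}_n(K)$, let $gI$ be the image of $I$ under the $K$-algebra automorphism of $A$ given by $X_i\mapsto\sum_{j=1}^n g_{ij}X_j$. Then there is a non-empty Zariski open set $U\subseteq \mathrm{GL}_n(K)\subseteq K^{n^2}$ such that $$\mathrm{Gf}(gI)=\mathrm{Gf}(hI)\qquad\text{for all } g,h\in U.$$ -/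

import Mathlib

namespace GrobnerFan

noncomputable section

/-- The scalar product `ω · a` of a weight with an exponent vector. -/
def weight {n : ℕ} (ω : Fin n → ℝ) (a : Fin n →₀ ℕ) : ℝ :=
  ∑ i, ω i * (a i : ℝ)

open Classical in
/-- The initial form of `f` with respect to `ω`: the sum of all terms of `f` of maximal weight. -/
def initialForm {K : Type*} [Field K] {n : ℕ} (ω : Fin n → ℝ) (f : MvPolynomial (Fin n) K) :
    MvPolynomial (Fin n) K :=
  ∑ a ∈ f.support.filter (fun a => ∀ b ∈ f.support, weight ω b ≤ weight ω a),
    MvPolynomial.monomial a (f.coeff a)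

/-- The initial ideal of `I` with respect to `ω`, generated by all initial forms of elements
of `I`. -/
def initialIdeal {K : Type*} [Field K] {n : ℕ} (ω : Fin n → ℝ)
    (I : Ideal (MvPolynomial (Fin n) K)) : Ideal (MvPolynomial (Fin n) K) :=
  Ideal.span (initialForm ω '' (I : Set (MvPolynomial (Fin n) K)))

/-- The class of `ω` for the equivalence relation "`I` has the same initial ideal" on weights. -/
def weightClass {K : Type*} [Field K] {n : ℕ} (I : Ideal (MvPolynomial (Fin n) K))
    (ω : Fin n → ℝ) : Set (Fin n → ℝ) :=
  {ω' | initialIdeal ω' I = initialIdeal ω I}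

/-- The Gröbner fan of `I`: the collection of the Euclidean closures of all equivalence classes
of weights. -/
def groebnerFan {K : Type*} [Field K] {n : ℕ} (I : Ideal (MvPolynomial (Fin n) K)) :
    Set (Set (Fin n → ℝ)) :=
  {C | ∃ ω : Fin n → ℝ, C = closure (weightClass I ω)}

/-- The linear change of coordinates `X i ↦ ∑ j, g i j * X j`. -/
def coordChange {K : Type*} [Field K] {n : ℕ} (g : Matrix.GeneralLinearGroup (Fin n) K) :
    MvPolynomial (Fin n) K →ₐ[K] MvPolynomial (Fin n) K :=
  MvPolynomial.aeval
    (fun i => ∑ j, MvPolynomial.C ((g : Matrix (Fin n) (Fin n) K) i j) * MvPolynomial.X j)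

/-- The ideal `gI`. (As `coordChange g` is bijective, this is just the image of `I`.) -/
def transform {K : Type*} [Field K] {n : ℕ} (g : Matrix.GeneralLinearGroup (Fin n) K)
    (I : Ideal (MvPolynomial (Fin n) K)) : Ideal (MvPolynomial (Fin n) K) :=
  I.map (coordChange g)

/-- Open subsets of `GL_n(K) ⊆ K^(n^2)` in the (subspace) Zariski topology: complements in
`GL_n(K)` of the common zero loci of sets of polynomials in the `n^2` matrix entries. -/
def IsZariskiOpen {K : Type*} [Field K] {n : ℕ} (U : Set (Matrix.GeneralLinearGroup (Fin n) K)) :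
    Prop :=
  ∃ S : Set (MvPolynomial (Fin n × Fin n) K),
    U = {g : Matrix.GeneralLinearGroup (Fin n) K | ∃ p ∈ S,
      MvPolynomial.eval (fun ij => (g : Matrix (Fin n) (Fin n) K) ij.1 ij.2) p ≠ 0}

end

end GrobnerFan

-- The standard grading of `K[X_1, …, X_n]` by total degree.
attribute [local instance] MvPolynomial.gradedAlgebra

/-! In degree `d`, the initial ideals of `gI` are governed by the matroid of `V = (gI)_d`, whose
bases are the sets `B` of exponents such that reading off the coefficients in `B` is an isomorphism
on `V`. Whether two weights give `V` the same initial subspace depends on these bases alone: some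
`B` must be optimal for both weights among its single exchanges, with the same ties
(`initialSubspace_eq_iff`).

A set `B` is a basis for `gI` exactly when a certain polynomial in the entries of `g`, essentially a
determinant, does not vanish (`exists_polynomial_isCoordBasis`). Over an infinite field, finitely
many such matroids are therefore simultaneously constant on a non-empty open set.

Finitely many degrees suffice: all initial ideals of all `gI` share the Hilbert function of `I`, and
monomial ideals with a given Hilbert function are generated in bounded degree, by compactness and
Dickson's lemma (`exists_degree_bound`, `exists_degree_initialIdeal_eq_iff`). So on the open set the
equivalence relation on weights, and hence the fan, does not depend on `g`. Over a finite field
`{1}` is open and nothing remains to be shown. -/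

namespace GrobnerFan

open MvPolynomial

/-! ### Leading exponents of a space of polynomials and its dimension -/

section LeadingExponents

variable {K : Type*} [Field K] {n : ℕ} {L : Type*} [LinearOrder L]

/-- The set of leading exponents of the elements of `V`, exponents being compared through `key`. -/
def leadSet (key : (Fin n →₀ ℕ) → L) (V : Submodule K (MvPolynomial (Fin n) K)) :
    Set (Fin n →₀ ℕ) :=
  {a | ∃ f ∈ V, a ∈ f.support ∧ ∀ b ∈ f.support, key b ≤ key a}

/-- The coefficients at the exponents in `B`. -/
noncomputable def restrictCoeff (B : Finset (Fin n →₀ ℕ)) : MvPolynomial (Fin n) K →ₗ[K] (B → K) :=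
  LinearMap.pi fun b => MvPolynomial.lcoeff K (b : Fin n →₀ ℕ)

@[simp] lemma restrictCoeff_apply (B : Finset (Fin n →₀ ℕ)) (f : MvPolynomial (Fin n) K) (b : B) :
    restrictCoeff B f b = f.coeff b := rfl

/-- In a vanishing combination, take the index `i` of largest key with non-zero coefficient: at the
exponent `e i` only `v i` contributes. -/
lemma linearIndependent_of_triangular {ι : Type*} {key : ι → L} (hkey : Function.Injective key)
    (e : ι → Fin n →₀ ℕ) (v : ι → MvPolynomial (Fin n) K) (hdiag : ∀ i, (v i).coeff (e i) ≠ 0)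
    (htri : ∀ i j, (v j).coeff (e i) ≠ 0 → key i ≤ key j) : LinearIndependent K v := by
  classical
  rw [linearIndependent_iff']
  intro s c hc
  by_contra! h
  obtain ⟨i₀, hi₀, hne⟩ := h
  obtain ⟨i, hi, hmax⟩ := (s.filter fun i => c i ≠ 0).exists_max_image key
    ⟨i₀, Finset.mem_filter.2 ⟨hi₀, hne⟩⟩
  rw [Finset.mem_filter] at hi
  have hcoeff := congrArg (MvPolynomial.coeff (e i)) hc
  rw [MvPolynomial.coeff_sum, Finset.sum_eq_single i] at hcoeff
  · rw [coeff_smul, coeff_zero, smul_eq_mul] at hcoeff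
    exact mul_ne_zero hi.2 (hdiag i) hcoeff
  · intro j hj hji
    rw [coeff_smul, smul_eq_mul]
    by_contra hne'
    obtain ⟨hcj, hvj⟩ := mul_ne_zero_iff.1 hne'
    exact hji (hkey (le_antisymm (hmax j (Finset.mem_filter.2 ⟨hj, hcj⟩)) (htri i j hvj)))
  · exact fun h => absurd hi.1 h

lemma exists_leading {key : (Fin n →₀ ℕ) → L} {f : MvPolynomial (Fin n) K} (hf : f ≠ 0) :
    ∃ a ∈ f.support, ∀ b ∈ f.support, key b ≤ key a :=
  f.support.exists_max_image key (MvPolynomial.support_nonempty.2 hf)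

lemma leadSet_finite {key : (Fin n →₀ ℕ) → L} (hkey : Function.Injective key)
    (V : Submodule K (MvPolynomial (Fin n) K)) [FiniteDimensional K V] :
    (leadSet key V).Finite ∧ (leadSet key V).ncard ≤ Module.finrank K V := by
  choose f hfV ha hmax using fun a : leadSet key V => a.2
  have hli : LinearIndependent K f := by
    refine linearIndependent_of_triangular (key := fun a : leadSet key V => key a)
      (hkey.comp Subtype.val_injective) (fun a => a) f (fun a => mem_support_iff.1 (ha a)) ?_
    exact fun i j h => hmax j i (mem_support_iff.2 h)
  have hli' : LinearIndependent K fun a => (⟨f a, hfV a⟩ : V) :=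
    LinearIndependent.of_comp V.subtype hli
  have hfin : Finite (leadSet key V) := hli'.finite
  have := Fintype.ofFinite (leadSet key V)
  refine ⟨hfin, ?_⟩
  rw [Set.ncard_eq_toFinset_card', Set.toFinset_card]
  exact hli'.fintype_card_le_finrank

lemma eq_zero_of_coeff_leadSet {key : (Fin n →₀ ℕ) → L} {V : Submodule K (MvPolynomial (Fin n) K)}
    {v : MvPolynomial (Fin n) K} (hv : v ∈ V) (h : ∀ a ∈ leadSet key V, v.coeff a = 0) : v = 0 := by
  by_contra hne
  obtain ⟨a, ha, hmax⟩ := exists_leading (key := key) hne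
  exact mem_support_iff.1 ha (h a ⟨v, hv, ha, hmax⟩)

lemma finrank_le_card {B : Finset (Fin n →₀ ℕ)} {V : Submodule K (MvPolynomial (Fin n) K)}
    (h : ∀ v ∈ V, (∀ b ∈ B, v.coeff b = 0) → v = 0) : Module.finrank K V ≤ B.card := by
  have := LinearMap.finrank_le_finrank_of_injective
    (f := (restrictCoeff B).comp V.subtype) (by
      rw [← LinearMap.ker_eq_bot, LinearMap.ker_eq_bot']
      intro v hv
      exact Subtype.ext (h v v.2 fun b hb => congrFun hv ⟨b, hb⟩))
  simpa using this

/-- One witness per leading exponent gives a triangular, hence independent, family. Conversely a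
non-zero vector cannot vanish at its own leading exponent, so the coefficients on the lead set
determine it. -/
lemma ncard_leadSet {key : (Fin n →₀ ℕ) → L} (hkey : Function.Injective key)
    (V : Submodule K (MvPolynomial (Fin n) K)) [FiniteDimensional K V] :
    (leadSet key V).ncard = Module.finrank K V := by
  obtain ⟨hfin, hle⟩ := leadSet_finite hkey V
  refine le_antisymm hle ?_
  rw [Set.ncard_eq_toFinset_card _ hfin]
  exact finrank_le_card fun v hv h =>
    eq_zero_of_coeff_leadSet hv fun a ha => h a (hfin.mem_toFinset.2 ha)

lemma eq_of_leadSet_subset {key : (Fin n →₀ ℕ) → L} (hkey : Function.Injective key)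
    {N W : Submodule K (MvPolynomial (Fin n) K)} [FiniteDimensional K W] (hNW : N ≤ W)
    (h : leadSet key W ⊆ leadSet key N) : N = W := by
  have : FiniteDimensional K N := Submodule.finiteDimensional_of_le hNW
  refine Submodule.eq_of_le_of_finrank_le hNW ?_
  rw [← ncard_leadSet hkey N, ← ncard_leadSet hkey W]
  exact Set.ncard_le_ncard h (leadSet_finite hkey N).1

end LeadingExponents

/-! ### The matroid of a space of polynomials -/

section CoordinateBases

variable {K : Type*} [Field K] {n : ℕ}

/-- `B` is a basis of the matroid of `V`: restricting to the coefficients in `B` is an isomorphism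
on `V`. -/
def IsCoordBasis (V : Submodule K (MvPolynomial (Fin n) K)) (B : Finset (Fin n →₀ ℕ)) : Prop :=
  B.card = Module.finrank K V ∧ ∀ v ∈ V, (∀ b ∈ B, v.coeff b = 0) → v = 0

lemma exists_isCoordBasis (V : Submodule K (MvPolynomial (Fin n) K)) [FiniteDimensional K V] :
    ∃ B, IsCoordBasis V B := by
  -- Any injective key would do; its lead set is a basis.
  have hkey : Function.Injective (toLex : (Fin n →₀ ℕ) → Lex (Fin n →₀ ℕ)) := toLex.injective
  have hfin := (leadSet_finite hkey V).1
  refine ⟨hfin.toFinset, ?_, fun v hv h => ?_⟩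
  · rw [← Set.ncard_eq_toFinset_card _ hfin, ncard_leadSet hkey]
  · exact eq_zero_of_coeff_leadSet hv fun a ha => h a (hfin.mem_toFinset.2 ha)

variable {V : Submodule K (MvPolynomial (Fin n) K)} {B : Finset (Fin n →₀ ℕ)}

/-- Dimensions agree, so injectivity of the restriction gives surjectivity. Allowing `b ∉ B` lets
dual vectors be chosen as a total function of `b`. -/
lemma IsCoordBasis.exists_dual [FiniteDimensional K V] (hB : IsCoordBasis V B)
    (b : Fin n →₀ ℕ) :
    ∃ v ∈ V, ∀ b' ∈ B, v.coeff b' = if b' = b then 1 else 0 := by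
  have hinj : Function.Injective ((restrictCoeff B).comp V.subtype) := by
    rw [← LinearMap.ker_eq_bot, LinearMap.ker_eq_bot']
    intro v hv
    exact Subtype.ext (hB.2 v v.2 fun b hb => congrFun hv ⟨b, hb⟩)
  have hsurj : Function.Surjective ((restrictCoeff B).comp V.subtype) :=
    (LinearMap.injective_iff_surjective_of_finrank_eq_finrank (by simp [hB.1])).1 hinj
  obtain ⟨v, hv⟩ := hsurj fun b' => if (b' : Fin n →₀ ℕ) = b then 1 else 0
  exact ⟨v, v.2, fun b' hb' => congrFun hv ⟨b', hb'⟩⟩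

lemma IsCoordBasis.eq_of_coeff_eq (hB : IsCoordBasis V B) {v w : MvPolynomial (Fin n) K}
    (hv : v ∈ V) (hw : w ∈ V) (h : ∀ b ∈ B, v.coeff b = w.coeff b) : v = w :=
  sub_eq_zero.1 (hB.2 _ (V.sub_mem hv hw) fun b hb => by rw [coeff_sub, h b hb, sub_self])

/-- The exchange property: the support of a dual basis vector records the bases that differ from `B`
by one exchange. -/
lemma IsCoordBasis.exchange_iff (hB : IsCoordBasis V B) {b j : Fin n →₀ ℕ} (hb : b ∈ B)
    (hj : j ∉ B) {v : MvPolynomial (Fin n) K} (hv : v ∈ V)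
    (hdual : ∀ b' ∈ B, v.coeff b' = if b' = b then 1 else 0) :
    IsCoordBasis V (insert j (B.erase b)) ↔ v.coeff j ≠ 0 := by
  constructor
  · intro h hvj
    have h0 := h.2 v hv fun b' hb' => by
      rcases Finset.mem_insert.1 hb' with rfl | hb'
      · exact hvj
      · rw [hdual b' (Finset.mem_of_mem_erase hb'), if_neg (Finset.ne_of_mem_erase hb')]
    have := hdual b hb
    simp [h0] at this
  · intro hvj
    refine ⟨?_, fun u hu h0 => ?_⟩
    · rw [Finset.card_insert_of_notMem fun h => hj (Finset.mem_of_mem_erase h),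
        Finset.card_erase_add_one hb, hB.1]
    · have hu' : u = u.coeff b • v := by
        refine hB.eq_of_coeff_eq hu (V.smul_mem _ hv) fun b' hb' => ?_
        rw [coeff_smul, hdual b' hb', smul_eq_mul]
        split_ifs with h
        · rw [h, mul_one]
        · rw [mul_zero]
          exact h0 b' (Finset.mem_insert_of_mem (Finset.mem_erase.2 ⟨h, hb'⟩))
      have hj0 := h0 j (Finset.mem_insert_self _ _)
      rw [hu', coeff_smul, smul_eq_mul] at hj0
      rw [hu', (mul_eq_zero.1 hj0).resolve_right hvj, zero_smul]

end CoordinateBases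

end GrobnerFan

namespace GrobnerFan

open MvPolynomial

/-! ### Initial forms and initial subspaces -/

section InitialSubspace

variable {K : Type*} [Field K] {n : ℕ}

lemma weight_add (ω : Fin n → ℝ) (a b : Fin n →₀ ℕ) :
    weight ω (a + b) = weight ω a + weight ω b := by
  simp [weight, mul_add, Finset.sum_add_distrib]

open Classical in
lemma coeff_initialForm (ω : Fin n → ℝ) (f : MvPolynomial (Fin n) K) (a : Fin n →₀ ℕ) :
    (initialForm ω f).coeff a =
      if ∀ b ∈ f.support, weight ω b ≤ weight ω a then f.coeff a else 0 := by
  rw [initialForm, coeff_sum]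
  simp only [coeff_monomial, Finset.sum_ite_eq', Finset.mem_filter, mem_support_iff]
  by_cases h : f.coeff a = 0 <;> simp [h]

lemma coeff_initialForm_ne_zero {ω : Fin n → ℝ} {f : MvPolynomial (Fin n) K} {a : Fin n →₀ ℕ} :
    (initialForm ω f).coeff a ≠ 0 ↔
      a ∈ f.support ∧ ∀ b ∈ f.support, weight ω b ≤ weight ω a := by
  rw [coeff_initialForm, mem_support_iff]
  split_ifs with h <;> simp_all

lemma mem_support_initialForm {ω : Fin n → ℝ} {f : MvPolynomial (Fin n) K} {a : Fin n →₀ ℕ} :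
    a ∈ (initialForm ω f).support ↔
      a ∈ f.support ∧ ∀ b ∈ f.support, weight ω b ≤ weight ω a := by
  rw [mem_support_iff, coeff_initialForm_ne_zero]

/-- The coefficients of the initial form of `f`, given an exponent `b` of `f` of maximal weight. -/
lemma initialForm_eq_of_support {ω : Fin n → ℝ} {f : MvPolynomial (Fin n) K} {b : Fin n →₀ ℕ}
    (hb : b ∈ f.support) (hmax : ∀ j ∈ f.support, weight ω j ≤ weight ω b) (a : Fin n →₀ ℕ) :
    (initialForm ω f).coeff a = if weight ω a = weight ω b then f.coeff a else 0 := by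
  classical
  rw [coeff_initialForm]
  by_cases ha : a ∈ f.support
  · refine if_congr ⟨fun h => le_antisymm (hmax a ha) (h b hb), fun h c hc => ?_⟩ rfl rfl
    rw [h]
    exact hmax c hc
  · rw [notMem_support_iff.1 ha, ite_self, ite_self]

@[simp] lemma initialForm_zero (ω : Fin n → ℝ) :
    initialForm ω (0 : MvPolynomial (Fin n) K) = 0 := by
  ext a
  simp [coeff_initialForm]

lemma initialForm_ne_zero {ω : Fin n → ℝ} {f : MvPolynomial (Fin n) K} (hf : f ≠ 0) :
    initialForm ω f ≠ 0 := by
  obtain ⟨a, ha, hmax⟩ := exists_leading (key := weight ω) hf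
  exact support_nonempty.1 ⟨a, mem_support_initialForm.2 ⟨ha, hmax⟩⟩

/-- The span of the initial forms of the elements of `V`. -/
noncomputable def initialSubspace (ω : Fin n → ℝ) (V : Submodule K (MvPolynomial (Fin n) K)) :
    Submodule K (MvPolynomial (Fin n) K) :=
  Submodule.span K (initialForm ω '' (V : Set (MvPolynomial (Fin n) K)))

lemma initialForm_mem_initialSubspace {ω : Fin n → ℝ} {V : Submodule K (MvPolynomial (Fin n) K)}
    {f : MvPolynomial (Fin n) K} (hf : f ∈ V) : initialForm ω f ∈ initialSubspace ω V :=
  Submodule.subset_span ⟨f, hf, rfl⟩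

/-- The component of weight `l` of an element of the initial subspace is the part of top weight of an
element of `V`. -/
lemma exists_lift_weight_component {ω : Fin n → ℝ} {V : Submodule K (MvPolynomial (Fin n) K)}
    {w : MvPolynomial (Fin n) K} (hw : w ∈ initialSubspace ω V) (l : ℝ) :
    ∃ f ∈ V, (∀ b ∈ f.support, weight ω b ≤ l) ∧
      ∀ b, weight ω b = l → f.coeff b = w.coeff b := by
  classical
  induction hw using Submodule.span_induction with
  | mem w hw =>
    obtain ⟨f, hf, rfl⟩ := hw
    by_cases h : ∃ a ∈ (initialForm ω f).support, weight ω a = l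
    · obtain ⟨a, ha, rfl⟩ := h
      obtain ⟨ha, hmax⟩ := mem_support_initialForm.1 ha
      refine ⟨f, hf, hmax, fun b hb => ?_⟩
      rw [initialForm_eq_of_support ha hmax, if_pos hb]
    · refine ⟨0, V.zero_mem, by simp, fun b hb => ?_⟩
      by_contra hne
      exact h ⟨b, mem_support_iff.2 (by simpa using Ne.symm hne), hb⟩
  | zero => exact ⟨0, V.zero_mem, by simp, by simp⟩
  | add x y _ _ hx hy =>
    obtain ⟨f, hf, hfle, hfc⟩ := hx
    obtain ⟨g, hg, hgle, hgc⟩ := hy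
    refine ⟨f + g, V.add_mem hf hg, fun b hb => ?_, fun b hb => ?_⟩
    · rcases Finset.mem_union.1 (support_add hb) with h | h
      exacts [hfle b h, hgle b h]
    · rw [coeff_add, coeff_add, hfc b hb, hgc b hb]
  | smul c x _ hx =>
    obtain ⟨f, hf, hfle, hfc⟩ := hx
    refine ⟨c • f, V.smul_mem c hf, fun b hb => hfle b (support_smul hb), fun b hb => ?_⟩
    rw [coeff_smul, coeff_smul, hfc b hb]

/-- The weight `ω`, with ties broken lexicographically. -/
noncomputable def weightLex (ω : Fin n → ℝ) (a : Fin n →₀ ℕ) : ℝ ×ₗ Lex (Fin n →₀ ℕ) :=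
  toLex (weight ω a, toLex a)

lemma weightLex_injective (ω : Fin n → ℝ) : Function.Injective (weightLex ω) := by
  intro a b h
  exact toLex.injective (congrArg Prod.snd (toLex.injective h))

lemma weightLex_le {ω : Fin n → ℝ} {a b : Fin n →₀ ℕ} :
    weightLex ω a ≤ weightLex ω b ↔
      weight ω a < weight ω b ∨ weight ω a = weight ω b ∧ toLex a ≤ toLex b :=
  Prod.Lex.toLex_le_toLex

lemma weightLex_add_le {ω : Fin n → ℝ} {a b : Fin n →₀ ℕ} (c : Fin n →₀ ℕ)
    (h : weightLex ω a ≤ weightLex ω b) : weightLex ω (a + c) ≤ weightLex ω (b + c) := by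
  rw [weightLex_le] at h ⊢
  rw [weight_add, weight_add, toLex_add, toLex_add]
  rcases h with h | ⟨h, h'⟩
  · exact Or.inl (by linarith)
  · exact Or.inr ⟨by rw [h], add_le_add_left h' _⟩

/-- Taking initial forms and then lexicographic leading terms is the same as using the refined
order. For `⊆`, lift the component of weight `ω · a` to an element of `V` having it as top part. -/
lemma leadSet_initialSubspace (ω : Fin n → ℝ) (V : Submodule K (MvPolynomial (Fin n) K)) :
    leadSet toLex (initialSubspace ω V) = leadSet (weightLex ω) V := by
  ext a
  constructor
  · rintro ⟨w, hw, ha, hmax⟩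
    obtain ⟨f, hf, hle, hc⟩ := exists_lift_weight_component hw (weight ω a)
    refine ⟨f, hf, mem_support_iff.2 (hc a rfl ▸ mem_support_iff.1 ha), fun b hb => ?_⟩
    rw [weightLex_le]
    refine (hle b hb).lt_or_eq.imp_right fun h => ⟨h, hmax b ?_⟩
    rw [mem_support_iff, ← hc b h]
    exact mem_support_iff.1 hb
  · rintro ⟨f, hf, ha, hmax⟩
    have hle : ∀ b ∈ f.support, weight ω b ≤ weight ω a := fun b hb =>
      (weightLex_le.1 (hmax b hb)).elim le_of_lt fun h => h.1.le
    refine ⟨_, initialForm_mem_initialSubspace hf, mem_support_initialForm.2 ⟨ha, hle⟩,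
      fun b hb => ?_⟩
    obtain ⟨hb, hb'⟩ := mem_support_initialForm.1 hb
    rcases weightLex_le.1 (hmax b hb) with h | h
    · exact absurd h (hb' a ha).not_gt
    · exact h.2

lemma initialForm_isHomogeneous {ω : Fin n → ℝ} {f : MvPolynomial (Fin n) K} {d : ℕ}
    (hf : f.IsHomogeneous d) : (initialForm ω f).IsHomogeneous d := by
  intro a ha
  exact hf (mem_support_iff.1 (coeff_initialForm_ne_zero.1 ha).1)

lemma initialSubspace_le_homogeneousSubmodule {ω : Fin n → ℝ}
    {V : Submodule K (MvPolynomial (Fin n) K)} {d : ℕ} (hV : V ≤ homogeneousSubmodule (Fin n) K d) :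
    initialSubspace ω V ≤ homogeneousSubmodule (Fin n) K d := by
  refine Submodule.span_le.2 ?_
  rintro _ ⟨f, hf, rfl⟩
  exact initialForm_isHomogeneous (hV hf)

lemma finiteDimensional_of_le_homogeneousSubmodule {V : Submodule K (MvPolynomial (Fin n) K)} {d : ℕ}
    (hV : V ≤ homogeneousSubmodule (Fin n) K d) : FiniteDimensional K V := by
  have : FiniteDimensional K (homogeneousSubmodule (Fin n) K d) :=
    Module.Finite.iff_fg.2 (homogeneousSubmodule_fg (Fin n) K d)
  exact Submodule.finiteDimensional_of_le hV

/-- Both dimensions count the same set of leading exponents. -/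
lemma finrank_initialSubspace (ω : Fin n → ℝ) {V : Submodule K (MvPolynomial (Fin n) K)} {d : ℕ}
    (hV : V ≤ homogeneousSubmodule (Fin n) K d) :
    Module.finrank K (initialSubspace ω V) = Module.finrank K V := by
  have := finiteDimensional_of_le_homogeneousSubmodule hV
  have := finiteDimensional_of_le_homogeneousSubmodule
    (initialSubspace_le_homogeneousSubmodule (ω := ω) hV)
  rw [← ncard_leadSet toLex.injective, leadSet_initialSubspace,
    ncard_leadSet (weightLex_injective ω)]

/-- Equality of initial subspaces can be read off from the matroid of `V`. -/
lemma initialSubspace_eq_iff {V : Submodule K (MvPolynomial (Fin n) K)} {d : ℕ}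
    (hV : V ≤ homogeneousSubmodule (Fin n) K d) (ω ω' : Fin n → ℝ) :
    initialSubspace ω V = initialSubspace ω' V ↔
      ∃ B, IsCoordBasis V B ∧ ∀ b ∈ B, ∀ j ∉ B, IsCoordBasis V (insert j (B.erase b)) →
        weight ω j ≤ weight ω b ∧ weight ω' j ≤ weight ω' b ∧
          (weight ω j = weight ω b ↔ weight ω' j = weight ω' b) := by
  classical
  have hfd := finiteDimensional_of_le_homogeneousSubmodule hV
  have hfdW := fun ω => finiteDimensional_of_le_homogeneousSubmodule
    (initialSubspace_le_homogeneousSubmodule (ω := ω) hV)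
  constructor
  · intro heq
    obtain ⟨B, hcard, hBW⟩ := exists_isCoordBasis (initialSubspace ω V)
    -- A vector of `V` vanishing on `B` has an initial form vanishing on `B`; that form is then
    -- zero, and so is the vector.
    have hB : IsCoordBasis V B := by
      refine ⟨by rw [hcard, finrank_initialSubspace ω hV], fun v hv h0 => ?_⟩
      by_contra hne
      refine initialForm_ne_zero (ω := ω) hne (hBW _ (initialForm_mem_initialSubspace hv) ?_)
      intro b hb
      rw [coeff_initialForm, h0 b hb, ite_self]
    refine ⟨B, hB, fun b hb j hj hex => ?_⟩
    obtain ⟨v, hv, hdual⟩ := hB.exists_dual b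
    have hvj := (hB.exchange_iff hb hj hv hdual).1 hex
    have hvb : b ∈ v.support := by simp [hdual b hb]
    have hne : v ≠ 0 := support_nonempty.1 ⟨b, hvb⟩
    -- The initial form of `v` is a non-zero element of the initial subspace, so its support meets
    -- `B`; but `v` meets `B` only in `b`.
    have key : ∀ η, initialSubspace ω V = initialSubspace η V →
        ∀ i ∈ v.support, weight η i ≤ weight η b := by
      intro η hη
      have hmem : initialForm η v ∈ initialSubspace ω V :=
        hη ▸ initialForm_mem_initialSubspace hv
      have : ∃ b' ∈ B, (initialForm η v).coeff b' ≠ 0 := by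
        by_contra! h
        exact initialForm_ne_zero (ω := η) hne (hBW _ hmem h)
      obtain ⟨b', hb', hcoeff⟩ := this
      obtain ⟨hb'v, hmax⟩ := coeff_initialForm_ne_zero.1 hcoeff
      have : b' = b := by
        by_contra h
        rw [mem_support_iff, hdual b' hb', if_neg h] at hb'v
        exact hb'v rfl
      exact this ▸ hmax
    have h := key ω rfl
    have h' := key ω' heq
    refine ⟨h j (mem_support_iff.2 hvj), h' j (mem_support_iff.2 hvj), ?_⟩
    -- Both initial forms lie in the same subspace and agree on its basis `B`, so they coincide;
    -- comparing coefficients at `j` matches the ties.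
    have hinit : initialForm ω v = initialForm ω' v := by
      refine sub_eq_zero.1 (hBW _ (Submodule.sub_mem _ (initialForm_mem_initialSubspace hv)
        (heq ▸ initialForm_mem_initialSubspace hv)) fun b' hb' => ?_)
      rw [coeff_sub, initialForm_eq_of_support hvb h, initialForm_eq_of_support hvb h',
        hdual b' hb']
      by_cases hbb : b' = b <;> simp [hbb]
    have := congrArg (coeff j) hinit
    rw [initialForm_eq_of_support hvb h, initialForm_eq_of_support hvb h'] at this
    by_cases h1 : weight ω j = weight ω b <;> by_cases h2 : weight ω' j = weight ω' b <;>
      simp_all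
  · rintro ⟨B, hB, hopt⟩
    choose v hv hdual using fun b => hB.exists_dual b
    have hvb : ∀ b ∈ B, b ∈ (v b).support := fun b hb => by simp [hdual b b hb]
    have hcond : ∀ b ∈ B, ∀ j ∈ (v b).support, weight ω j ≤ weight ω b ∧
        weight ω' j ≤ weight ω' b ∧ (weight ω j = weight ω b ↔ weight ω' j = weight ω' b) := by
      intro b hb j hj
      by_cases hjB : j ∈ B
      · have : j = b := by
          by_contra h
          rw [mem_support_iff, hdual b j hjB, if_neg h] at hj
          exact hj rfl
        simp [this]
      · exact hopt b hb j hjB ((hB.exchange_iff hb hjB (hv b) (hdual b)).2 (mem_support_iff.1 hj))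
    -- When every `b` is optimal, the initial forms of the dual vectors are still dual to `B`, hence
    -- independent, and there are enough of them to span.
    have hspan : ∀ η, (∀ b ∈ B, ∀ j ∈ (v b).support, weight η j ≤ weight η b) →
        Submodule.span K (Set.range fun b : B => initialForm η (v b)) = initialSubspace η V := by
      intro η hη
      have hco : ∀ b b' : B,
          (initialForm η (v b)).coeff b' = if b' = b then 1 else 0 := by
        intro b b'
        rw [initialForm_eq_of_support (hvb b b.2) (hη b b.2), hdual b b' b'.2]
        by_cases h : b' = b
        · simp [h]
        · simp [h, Subtype.coe_injective.ne h]
      have hli : LinearIndependent K fun b : B => initialForm η (v b) := by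
        refine linearIndependent_of_triangular (key := fun b : B => toLex (b : Fin n →₀ ℕ))
          (toLex.injective.comp Subtype.val_injective) (fun b => b) _ (fun b => by simp [hco]) ?_
        intro i j h
        rw [hco] at h
        have : i = j := by by_contra hne; exact h (if_neg hne)
        rw [this]
      have := hfdW η
      refine Submodule.eq_of_le_of_finrank_eq (Submodule.span_le.2 ?_) ?_
      · rintro _ ⟨b, rfl⟩
        exact initialForm_mem_initialSubspace (hv b)
      · rw [finrank_span_eq_card hli, Fintype.card_coe, hB.1, finrank_initialSubspace η hV]
    rw [← hspan ω fun b hb j hj => (hcond b hb j hj).1,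
      ← hspan ω' fun b hb j hj => (hcond b hb j hj).2.1]
    congr 2
    funext b
    ext j
    rw [initialForm_eq_of_support (hvb b b.2) fun j hj => (hcond b b.2 j hj).1,
      initialForm_eq_of_support (hvb b b.2) fun j hj => (hcond b b.2 j hj).2.1]
    by_cases hj : j ∈ (v b).support
    · exact if_congr (hcond b b.2 j hj).2.2 rfl rfl
    · rw [notMem_support_iff.1 hj, ite_self, ite_self]

end InitialSubspace

end GrobnerFan

/-! ### Monomial ideals with a fixed Hilbert function -/

namespace GrobnerFan

/-- Upper sets of exponents with a given Hilbert function are generated in bounded degree. -/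
lemma exists_degree_bound {n : ℕ} (H : ℕ → ℕ) :
    ∃ D : ℕ, ∀ M : Set (Fin n →₀ ℕ), IsUpperSet M →
      (∀ d, (M ∩ {a | a.degree = d}).ncard = H d) → ∀ a ∈ M, ∃ b ∈ M, b ≤ a ∧ b.degree ≤ D := by
  by_contra! hbad
  choose M hup hH a ha hgen using hbad
  -- Compactness: `N` is the limit, along a non-principal ultrafilter, of counterexamples `M k` to
  -- the bound `k`. In each bounded range of degrees it agrees with `M k` for almost all `k`.
  let F : Filter ℕ := (Filter.hyperfilter ℕ : Filter ℕ)
  let N : Set (Fin n →₀ ℕ) := {a | ∀ᶠ k in F, a ∈ M k}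
  have hfin : ∀ d : ℕ, {a : Fin n →₀ ℕ | a.degree = d}.Finite := fun d =>
    (Finsupp.finite_of_degree_le d).subset fun a (h : a.degree = d) => h.le
  have hagree : ∀ d : ℕ, ∀ᶠ k in F, ∀ a : Fin n →₀ ℕ, a.degree ≤ d → (a ∈ M k ↔ a ∈ N) := by
    intro d
    have : ∀ᶠ k in F, ∀ a ∈ {a : Fin n →₀ ℕ | a.degree ≤ d}, (a ∈ M k ↔ a ∈ N) := by
      rw [Filter.eventually_all_finite (Finsupp.finite_of_degree_le d)]
      intro a _
      by_cases h : a ∈ N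
      · exact (show ∀ᶠ k in F, a ∈ M k from h).mono fun k hk => iff_of_true hk h
      · exact (Ultrafilter.eventually_not.2 h).mono fun k hk => iff_of_false hk h
    exact this
  have hNup : IsUpperSet N := fun a b hab (h : ∀ᶠ k in F, a ∈ M k) =>
    h.mono fun k hk => hup k hab hk
  have hNH : ∀ d, (N ∩ {a | a.degree = d}).ncard = H d := by
    intro d
    obtain ⟨k, hk⟩ := (hagree d).exists
    rw [← hH k d]
    congr 1
    ext a
    exact and_congr_left fun h => (hk a (le_of_eq h)).symm
  -- Dickson's lemma: the minimal elements of `N` form an antichain, hence a finite set.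
  obtain ⟨D, hD⟩ : ∃ D, ∀ a ∈ N, ∃ b ∈ N, b ≤ a ∧ b.degree ≤ D := by
    have hanti : {b | Minimal (· ∈ N) b}.Finite :=
      WellQuasiOrderedLE.finite_of_isAntichain (setOfPred_minimal_antichain _)
    obtain ⟨D, hD⟩ := (hanti.image Finsupp.degree).bddAbove
    refine ⟨D, fun a ha => ?_⟩
    obtain ⟨b, hba, hb⟩ := exists_minimal_le_of_wellFoundedLT (· ∈ N) a ha
    exact ⟨b, hb.prop, hba, hD ⟨b, hb, rfl⟩⟩
  have hlarge : ∀ᶠ k in F, D ≤ k :=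
    Filter.Eventually.filter_mono Nat.hyperfilter_le_atTop (Filter.eventually_ge_atTop D)
  obtain ⟨k, hk, hDk⟩ := ((hagree D).and hlarge).exists
  have hsub : N ⊆ M k := by
    intro a ha
    obtain ⟨b, hb, hba, hbD⟩ := hD a ha
    exact hup k hba ((hk b hbD).2 hb)
  -- The inclusion `N ⊆ M k` is an equality in every degree, as both sides have the same finite
  -- cardinality there.
  have hmem : a k ∈ N := by
    have := Set.eq_of_subset_of_ncard_le
      (Set.inter_subset_inter_left {b | b.degree = (a k).degree} hsub)
      (by rw [hH k, hNH]) ((hfin _).subset Set.inter_subset_right)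
    exact (this.ge ⟨ha k, rfl⟩).1
  obtain ⟨b, hb, hba, hbD⟩ := hD _ hmem
  exact absurd (hgen k b (hsub hb) hba) (by omega)

end GrobnerFan

namespace GrobnerFan

open MvPolynomial

/-! ### Reducing initial ideals to finitely many degrees -/

section HomogeneousIdeals

variable {K : Type*} [Field K] {n : ℕ}

/-- The elements of `J` that are homogeneous of degree `d`. -/
noncomputable def homogeneousPiece (J : Ideal (MvPolynomial (Fin n) K)) (d : ℕ) :
    Submodule K (MvPolynomial (Fin n) K) :=
  J.restrictScalars K ⊓ homogeneousSubmodule (Fin n) K d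

lemma homogeneousPiece_le (J : Ideal (MvPolynomial (Fin n) K)) (d : ℕ) :
    homogeneousPiece J d ≤ homogeneousSubmodule (Fin n) K d :=
  inf_le_right

lemma mem_homogeneousPiece {J : Ideal (MvPolynomial (Fin n) K)} {d : ℕ}
    {f : MvPolynomial (Fin n) K} : f ∈ homogeneousPiece J d ↔ f ∈ J ∧ f.IsHomogeneous d :=
  Iff.rfl

lemma degree_eq_of_mem_support {f : MvPolynomial (Fin n) K} {d : ℕ}
    (hf : f.IsHomogeneous d) {a : Fin n →₀ ℕ} (ha : a ∈ f.support) : a.degree = d := by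
  by_contra h
  exact mem_support_iff.1 ha (hf.coeff_eq_zero h)

lemma mem_support_monomial_mul {f : MvPolynomial (Fin n) K} {a c : Fin n →₀ ℕ} :
    a ∈ (monomial c 1 * f).support ↔ ∃ b ∈ f.support, a = b + c := by
  rw [mem_support_iff, coeff_monomial_mul']
  constructor
  · intro h
    split_ifs at h with hca
    · exact ⟨a - c, mem_support_iff.2 (by simpa using h), (tsub_add_cancel_of_le hca).symm⟩
    · exact absurd rfl h
  · rintro ⟨b, hb, rfl⟩
    rw [if_pos le_add_self, add_tsub_cancel_right, one_mul]
    exact mem_support_iff.1 hb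

lemma initialForm_monomial_mul (ω : Fin n → ℝ) (c : Fin n →₀ ℕ) (f : MvPolynomial (Fin n) K) :
    initialForm ω (monomial c 1 * f) = monomial c 1 * initialForm ω f := by
  classical
  ext a
  rw [coeff_monomial_mul']
  split_ifs with hca
  · obtain ⟨b, rfl⟩ := exists_add_of_le hca
    rw [add_tsub_cancel_left, coeff_initialForm, coeff_initialForm, coeff_monomial_mul]
    simp only [one_mul, mul_ite, mul_zero]
    refine if_congr ⟨fun h e he => ?_, fun h e he => ?_⟩ rfl rfl
    · have := h (e + c) (mem_support_monomial_mul.2 ⟨e, he, rfl⟩)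
      rw [weight_add, weight_add] at this
      linarith
    · obtain ⟨e, he', rfl⟩ := mem_support_monomial_mul.1 he
      rw [weight_add, weight_add]
      linarith [h e he']
  · rw [coeff_initialForm, coeff_monomial_mul', if_neg hca, ite_self]

/-- The linear span of the initial forms is already an ideal, since taking initial forms commutes
with multiplication by monomials. -/
lemma mem_initialIdeal_iff {ω : Fin n → ℝ} {J : Ideal (MvPolynomial (Fin n) K)}
    {f : MvPolynomial (Fin n) K} :
    f ∈ initialIdeal ω J ↔ f ∈ initialSubspace ω (J.restrictScalars K) := by
  constructor
  · intro hf
    refine Submodule.span_induction ?_ (Submodule.zero_mem _)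
      (fun _ _ _ _ => Submodule.add_mem _) ?_ hf
    · rintro _ ⟨f, hf, rfl⟩
      exact initialForm_mem_initialSubspace hf
    · intro p x _ hx
      induction p using MvPolynomial.induction_on' with
      | add p q hp hq => rw [add_smul]; exact Submodule.add_mem _ hp hq
      | monomial c r =>
        have : monomial c r • x = r • (monomial c 1 * x) := by
          rw [smul_eq_mul, ← smul_mul_assoc, smul_monomial, smul_eq_mul, mul_one]
        rw [this]
        refine Submodule.smul_mem _ _ ?_
        refine Submodule.span_induction (p := fun x _ => monomial c 1 * x ∈ _) ?_ ?_ ?_ ?_ hx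
        · rintro _ ⟨f, hf, rfl⟩
          rw [← initialForm_monomial_mul]
          exact initialForm_mem_initialSubspace (J.mul_mem_left _ hf)
        · rw [mul_zero]; exact Submodule.zero_mem _
        · intro x y _ _ hx hy
          rw [mul_add]; exact Submodule.add_mem _ hx hy
        · intro t x _ hx
          rw [mul_smul_comm]; exact Submodule.smul_mem _ _ hx
  · intro hf
    refine Submodule.span_induction (p := fun f _ => f ∈ initialIdeal ω J) ?_ (Ideal.zero_mem _)
      (fun _ _ _ _ => Ideal.add_mem _) (fun t x _ hx => ?_) hf
    · intro f hf
      exact Ideal.subset_span hf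
    · rw [smul_eq_C_mul]
      exact Ideal.mul_mem_left _ _ hx

lemma initialSubspace_mono (ω : Fin n → ℝ) {V W : Submodule K (MvPolynomial (Fin n) K)}
    (h : V ≤ W) : initialSubspace ω V ≤ initialSubspace ω W :=
  Submodule.span_mono (Set.image_mono h)

lemma initialSubspace_homogeneousPiece_le (ω : Fin n → ℝ) (J : Ideal (MvPolynomial (Fin n) K))
    (d : ℕ) : initialSubspace ω (homogeneousPiece J d) ≤ (initialIdeal ω J).restrictScalars K :=
  fun _ hf => mem_initialIdeal_iff.2 (initialSubspace_mono ω inf_le_left hf)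

lemma homogeneousComponent_mem_initialSubspace {ω : Fin n → ℝ}
    {J : Ideal (MvPolynomial (Fin n) K)} (hJ : ∀ f ∈ J, ∀ d, homogeneousComponent d f ∈ J)
    {f : MvPolynomial (Fin n) K} (hf : f ∈ initialIdeal ω J) (d : ℕ) :
    homogeneousComponent d f ∈ initialSubspace ω (homogeneousPiece J d) := by
  classical
  refine Submodule.span_induction
    (p := fun f _ => homogeneousComponent d f ∈ initialSubspace ω (homogeneousPiece J d))
    ?_ ?_ ?_ ?_ (mem_initialIdeal_iff.1 hf)
  · rintro _ ⟨f, hf, rfl⟩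
    by_cases h0 : homogeneousComponent d (initialForm ω f) = 0
    · rw [h0]; exact Submodule.zero_mem _
    obtain ⟨a, ha⟩ := support_nonempty.2 h0
    rw [mem_support_iff, coeff_homogeneousComponent, ne_eq, ite_eq_right_iff,
      Classical.not_imp, ← ne_eq, coeff_initialForm_ne_zero] at ha
    obtain ⟨had, haf, hmax⟩ := ha
    have hsupp : ∀ b ∈ (homogeneousComponent d f).support, b ∈ f.support := by
      intro b hb
      rw [mem_support_iff, coeff_homogeneousComponent] at hb
      exact mem_support_iff.2 fun h => hb (by rw [h, ite_self])
    have haf' : a ∈ (homogeneousComponent d f).support := by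
      rw [mem_support_iff, coeff_homogeneousComponent, if_pos had]
      exact mem_support_iff.1 haf
    -- The maximal weight of `f` is attained at `a`, of degree `d`, so it is also the maximal weight
    -- of the degree-`d` component.
    have : homogeneousComponent d (initialForm ω f) = initialForm ω (homogeneousComponent d f) := by
      ext b
      rw [coeff_homogeneousComponent, initialForm_eq_of_support haf hmax,
        initialForm_eq_of_support haf' fun b hb => hmax b (hsupp b hb),
        coeff_homogeneousComponent]
      split_ifs <;> rfl
    rw [this]
    exact initialForm_mem_initialSubspace ⟨hJ f hf d, homogeneousComponent_isHomogeneous d f⟩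
  · rw [map_zero]; exact Submodule.zero_mem _
  · intro x y _ _ hx hy
    rw [map_add]; exact Submodule.add_mem _ hx hy
  · intro t x _ hx
    rw [map_smul]; exact Submodule.smul_mem _ _ hx

lemma initialSubspace_homogeneousPiece_eq {ω ω' : Fin n → ℝ}
    {J : Ideal (MvPolynomial (Fin n) K)} (hJ : ∀ f ∈ J, ∀ d, homogeneousComponent d f ∈ J)
    (h : initialIdeal ω J = initialIdeal ω' J) (d : ℕ) :
    initialSubspace ω (homogeneousPiece J d) = initialSubspace ω' (homogeneousPiece J d) := by
  have aux : ∀ η η' : Fin n → ℝ, initialIdeal η J = initialIdeal η' J →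
      initialSubspace η (homogeneousPiece J d) ≤ initialSubspace η' (homogeneousPiece J d) := by
    intro η η' h f hf
    have hfd : f.IsHomogeneous d :=
      initialSubspace_le_homogeneousSubmodule (homogeneousPiece_le J d) hf
    have := homogeneousComponent_mem_initialSubspace hJ
      (h ▸ initialSubspace_homogeneousPiece_le η J d hf) d
    rwa [homogeneousComponent_eq_self hfd] at this
  exact le_antisymm (aux ω ω' h) (aux ω' ω h.symm)

/-- The exponents of the initial monomials of the homogeneous elements of `J`. -/
def leadExponents (ω : Fin n → ℝ) (J : Ideal (MvPolynomial (Fin n) K)) : Set (Fin n →₀ ℕ) :=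
  {a | a ∈ leadSet (weightLex ω) (homogeneousPiece J a.degree)}

lemma leadExponents_inter (ω : Fin n → ℝ) (J : Ideal (MvPolynomial (Fin n) K)) (d : ℕ) :
    leadExponents ω J ∩ {a | a.degree = d} = leadSet (weightLex ω) (homogeneousPiece J d) := by
  ext a
  constructor
  · rintro ⟨h, rfl⟩
    exact h
  · intro h
    have had : a.degree = d := by
      obtain ⟨f, hf, ha, -⟩ := h
      exact degree_eq_of_mem_support hf.2 ha
    subst had
    exact ⟨h, rfl⟩

lemma leadSet_add {L : Type*} [LinearOrder L] {key : (Fin n →₀ ℕ) → L} {c : Fin n →₀ ℕ}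
    (hkey : ∀ a b, key a ≤ key b → key (a + c) ≤ key (b + c))
    {V W : Submodule K (MvPolynomial (Fin n) K)} (hVW : ∀ f ∈ V, monomial c 1 * f ∈ W)
    {a : Fin n →₀ ℕ} (ha : a ∈ leadSet key V) : a + c ∈ leadSet key W := by
  obtain ⟨f, hf, haf, hmax⟩ := ha
  refine ⟨_, hVW f hf, mem_support_monomial_mul.2 ⟨a, haf, rfl⟩, fun b hb => ?_⟩
  obtain ⟨b', hb', rfl⟩ := mem_support_monomial_mul.1 hb
  exact hkey _ _ (hmax b' hb')

lemma monomial_mul_isHomogeneous {f : MvPolynomial (Fin n) K} {d : ℕ} (hf : f.IsHomogeneous d)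
    (c : Fin n →₀ ℕ) : (monomial c 1 * f).IsHomogeneous (d + c.degree) := by
  rw [add_comm]
  exact (isHomogeneous_monomial 1 rfl).mul hf

lemma leadExponents_isUpperSet (ω : Fin n → ℝ) (J : Ideal (MvPolynomial (Fin n) K)) :
    IsUpperSet (leadExponents ω J) := by
  intro a b hab ha
  obtain ⟨c, rfl⟩ := exists_add_of_le hab
  have hmul : ∀ f ∈ homogeneousPiece J a.degree,
      monomial c 1 * f ∈ homogeneousPiece J (a + c).degree := by
    intro f hf
    rw [mem_homogeneousPiece] at hf ⊢
    rw [map_add]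
    exact ⟨J.mul_mem_left _ hf.1, monomial_mul_isHomogeneous hf.2 c⟩
  exact leadSet_add (key := weightLex ω) (fun _ _ => weightLex_add_le c) hmul ha

/-- If the initial monomials of `J` are generated in degrees at most `D`, then so is the initial
ideal of `J`. -/
lemma initialIdeal_le_of_initialSubspace_le {ω : Fin n → ℝ} {J N : Ideal (MvPolynomial (Fin n) K)}
    (hJ : ∀ f ∈ J, ∀ d, homogeneousComponent d f ∈ J) {D : ℕ}
    (hD : ∀ a ∈ leadExponents ω J, ∃ b ∈ leadExponents ω J, b ≤ a ∧ b.degree ≤ D)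
    (hN : ∀ d ≤ D, initialSubspace ω (homogeneousPiece J d) ≤ N.restrictScalars K) :
    initialIdeal ω J ≤ N := by
  have hW : ∀ d, initialSubspace ω (homogeneousPiece J d) ≤ homogeneousSubmodule (Fin n) K d :=
    fun d => initialSubspace_le_homogeneousSubmodule (homogeneousPiece_le J d)
  -- Comparing leading exponents suffices: each one is a multiple of one of degree at most `D`,
  -- whose witness lies in `N` and can be multiplied by a monomial.
  have key : ∀ d, N.restrictScalars K ⊓ initialSubspace ω (homogeneousPiece J d) =
      initialSubspace ω (homogeneousPiece J d) := by
    intro d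
    have := finiteDimensional_of_le_homogeneousSubmodule (hW d)
    refine eq_of_leadSet_subset (key := toLex) toLex.injective inf_le_right fun a ha => ?_
    rw [leadSet_initialSubspace, ← leadExponents_inter] at ha
    obtain ⟨haM, rfl⟩ := ha
    obtain ⟨b, hb, hba, hbD⟩ := hD a haM
    obtain ⟨c, rfl⟩ := exists_add_of_le hba
    change b ∈ leadSet _ _ at hb
    rw [← leadSet_initialSubspace] at hb
    refine leadSet_add (fun a b h => ?_) (fun f hf => Submodule.mem_inf.2
      ⟨N.mul_mem_left _ (hN _ hbD hf), ?_⟩) hb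
    · rw [toLex_add, toLex_add]
      exact add_le_add_left h _
    have hI : monomial c 1 * f ∈ initialIdeal ω J :=
      Ideal.mul_mem_left _ _ (initialSubspace_homogeneousPiece_le ω J _ hf)
    have := homogeneousComponent_mem_initialSubspace hJ hI (b + c).degree
    rwa [homogeneousComponent_eq_self] at this
    rw [map_add]
    exact monomial_mul_isHomogeneous (hW _ hf) c
  intro f hf
  rw [← sum_homogeneousComponent f]
  refine N.sum_mem fun d _ => ?_
  have := homogeneousComponent_mem_initialSubspace hJ hf d
  rw [← key d] at this
  exact this.1

/-- The initial ideals of the homogeneous ideals with a given Hilbert function are determined in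
bounded degree. -/
lemma exists_degree_initialIdeal_eq_iff (K : Type*) [Field K] (n : ℕ) (H : ℕ → ℕ) :
    ∃ D : ℕ, ∀ J : Ideal (MvPolynomial (Fin n) K), (∀ f ∈ J, ∀ d, homogeneousComponent d f ∈ J) →
      (∀ d, Module.finrank K (homogeneousPiece J d) = H d) → ∀ ω ω' : Fin n → ℝ,
        (initialIdeal ω J = initialIdeal ω' J ↔ ∀ d ≤ D,
          initialSubspace ω (homogeneousPiece J d) = initialSubspace ω' (homogeneousPiece J d)) := by
  obtain ⟨D, hD⟩ := exists_degree_bound (n := n) H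
  refine ⟨D, fun J hJ hH ω ω' =>
    ⟨fun h d _ => initialSubspace_homogeneousPiece_eq hJ h d, fun h => ?_⟩⟩
  -- The bound `D` depends only on `H`, so it serves all weights at once.
  have hgen : ∀ η, ∀ a ∈ leadExponents η J, ∃ b ∈ leadExponents η J, b ≤ a ∧ b.degree ≤ D := by
    intro η
    refine hD _ (leadExponents_isUpperSet η J) fun d => ?_
    have := finiteDimensional_of_le_homogeneousSubmodule (homogeneousPiece_le J d)
    rw [leadExponents_inter, ncard_leadSet (weightLex_injective η), hH]
  refine le_antisymm ?_ ?_
  · refine initialIdeal_le_of_initialSubspace_le hJ (hgen ω) fun d hd => ?_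
    rw [h d hd]
    exact initialSubspace_homogeneousPiece_le ω' J d
  · refine initialIdeal_le_of_initialSubspace_le hJ (hgen ω') fun d hd => ?_
    rw [← h d hd]
    exact initialSubspace_homogeneousPiece_le ω J d

end HomogeneousIdeals

/-! ### Linear coordinate changes, specific and generic -/

section CoordinateChange

variable {K : Type*} [Field K] {n : ℕ}

lemma coordChange_X (g : Matrix.GeneralLinearGroup (Fin n) K) (i : Fin n) :
    coordChange g (X i) = ∑ j, C ((g : Matrix (Fin n) (Fin n) K) i j) * X j := by
  rw [coordChange, aeval_X]

/-- The order reverses: substituting by `g` in `∑ j, h i j * X j` produces row `i` of `h * g`. -/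
lemma coordChange_comp (g h : Matrix.GeneralLinearGroup (Fin n) K) :
    (coordChange g).comp (coordChange h) = coordChange (h * g) := by
  refine MvPolynomial.algHom_ext fun i => ?_
  have hC : ∀ r : K, coordChange g (C r) = C r := fun r => (coordChange g).commutes r
  rw [AlgHom.comp_apply, coordChange_X, coordChange_X]
  simp only [map_sum, map_mul, hC, coordChange_X, Units.val_mul, Matrix.mul_apply,
    Finset.mul_sum, Finset.sum_mul, mul_assoc]
  exact Finset.sum_comm

lemma coordChange_one : coordChange (1 : Matrix.GeneralLinearGroup (Fin n) K) = AlgHom.id K _ := by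
  refine MvPolynomial.algHom_ext fun i => ?_
  rw [coordChange_X, Finset.sum_eq_single i] <;> simp +contextual [eq_comm]

lemma coordChange_inv_apply (g : Matrix.GeneralLinearGroup (Fin n) K)
    (f : MvPolynomial (Fin n) K) : coordChange g (coordChange g⁻¹ f) = f := by
  rw [← AlgHom.comp_apply, coordChange_comp, inv_mul_cancel, coordChange_one, AlgHom.id_apply]

lemma coordChange_surjective (g : Matrix.GeneralLinearGroup (Fin n) K) :
    Function.Surjective (coordChange g) :=
  fun f => ⟨_, coordChange_inv_apply g f⟩

lemma coordChange_injective (g : Matrix.GeneralLinearGroup (Fin n) K) :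
    Function.Injective (coordChange g) := by
  refine Function.LeftInverse.injective (g := coordChange g⁻¹) fun f => ?_
  have := coordChange_inv_apply g⁻¹ f
  rwa [inv_inv] at this

lemma finrank_map_coordChange (g : Matrix.GeneralLinearGroup (Fin n) K)
    (V : Submodule K (MvPolynomial (Fin n) K)) :
    Module.finrank K (V.map (coordChange g).toLinearMap) = Module.finrank K V :=
  (Submodule.equivMapOfInjective (coordChange g).toLinearMap (coordChange_injective g) V).finrank_eq.symm

lemma coordChange_isHomogeneous (g : Matrix.GeneralLinearGroup (Fin n) K)
    {f : MvPolynomial (Fin n) K} {d : ℕ} (hf : f.IsHomogeneous d) :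
    (coordChange g f).IsHomogeneous d := by
  have := hf.aeval (fun i => ∑ j, C ((g : Matrix (Fin n) (Fin n) K) i j) * X j) (n := 1)
    fun i => IsHomogeneous.sum _ _ _ fun j _ => isHomogeneous_C_mul_X _ _
  rwa [one_mul] at this

lemma homogeneousComponent_coordChange (g : Matrix.GeneralLinearGroup (Fin n) K)
    (f : MvPolynomial (Fin n) K) (d : ℕ) :
    homogeneousComponent d (coordChange g f) = coordChange g (homogeneousComponent d f) := by
  classical
  conv_lhs => rw [← sum_homogeneousComponent f, map_sum, map_sum]
  have h : ∀ i, homogeneousComponent d (coordChange g (homogeneousComponent i f)) =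
      if i = d then coordChange g (homogeneousComponent i f) else 0 := fun i => by
    rw [homogeneousComponent_of_mem
      (coordChange_isHomogeneous g (homogeneousComponent_isHomogeneous i f))]
    exact if_congr eq_comm rfl rfl
  rw [Finset.sum_congr rfl fun i _ => h i, Finset.sum_ite_eq']
  split_ifs with hd
  · rfl
  · rw [homogeneousComponent_eq_zero _ _ (by simpa using hd), map_zero]

lemma mem_transform_iff {g : Matrix.GeneralLinearGroup (Fin n) K}
    {I : Ideal (MvPolynomial (Fin n) K)} {f : MvPolynomial (Fin n) K} :
    f ∈ transform g I ↔ ∃ f' ∈ I, coordChange g f' = f :=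
  Ideal.mem_map_iff_of_surjective _ (coordChange_surjective g)

lemma homogeneousComponent_mem_transform {g : Matrix.GeneralLinearGroup (Fin n) K}
    {I : Ideal (MvPolynomial (Fin n) K)} (hI : ∀ f ∈ I, ∀ d, homogeneousComponent d f ∈ I) :
    ∀ f ∈ transform g I, ∀ d, homogeneousComponent d f ∈ transform g I := by
  intro f hf d
  obtain ⟨f, hfI, rfl⟩ := mem_transform_iff.1 hf
  exact mem_transform_iff.2 ⟨_, hI f hfI d, (homogeneousComponent_coordChange g f d).symm⟩

lemma homogeneousPiece_transform (g : Matrix.GeneralLinearGroup (Fin n) K)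
    (I : Ideal (MvPolynomial (Fin n) K)) (d : ℕ) :
    homogeneousPiece (transform g I) d =
      (homogeneousPiece I d).map (coordChange g).toLinearMap := by
  ext f
  constructor
  · rintro ⟨hf, hfd⟩
    obtain ⟨f, hfI, rfl⟩ := mem_transform_iff.1 hf
    refine ⟨f, ⟨hfI, ?_⟩, rfl⟩
    have := coordChange_isHomogeneous g⁻¹ hfd
    have hinv := coordChange_inv_apply g⁻¹ f
    rw [inv_inv] at hinv
    rwa [hinv] at this
  · rintro ⟨f, ⟨hf, hfd⟩, rfl⟩
    exact ⟨mem_transform_iff.2 ⟨f, hf, rfl⟩, coordChange_isHomogeneous g hfd⟩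

/-- The change of coordinates by the matrix of indeterminates. -/
noncomputable def genericChange (K : Type*) [Field K] (n : ℕ) :
    MvPolynomial (Fin n) K →ₐ[K] MvPolynomial (Fin n) (MvPolynomial (Fin n × Fin n) K) :=
  aeval fun i => ∑ j, C (X (i, j)) * X j

/-- The point of affine space given by the entries of `g`. -/
def entries (g : Matrix.GeneralLinearGroup (Fin n) K) : Fin n × Fin n → K :=
  fun ij => (g : Matrix (Fin n) (Fin n) K) ij.1 ij.2

lemma map_eval_genericChange (g : Matrix.GeneralLinearGroup (Fin n) K)
    (f : MvPolynomial (Fin n) K) :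
    MvPolynomial.map (eval (entries g)) (genericChange K n f) = coordChange g f := by
  have : (MvPolynomial.map (eval (entries g))).comp (genericChange K n).toRingHom =
      (coordChange g).toRingHom := by
    refine MvPolynomial.ringHom_ext (fun r => ?_) fun i => ?_
    · have h1 : genericChange K n (C r) = C (C r) := (genericChange K n).commutes r
      have h2 : coordChange g (C r) = C r := (coordChange g).commutes r
      simp [h1, h2]
    · simp [genericChange, coordChange_X, entries]
  exact RingHom.congr_fun this f

/-- Transform a basis of `V` by the generic matrix and take the determinant of the coefficients at
`B`; specializing at `g` tests whether restriction to `B` is injective. If `B` has the wrong size,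
`p = 0` works. -/
lemma exists_polynomial_isCoordBasis {V : Submodule K (MvPolynomial (Fin n) K)}
    [FiniteDimensional K V] (B : Finset (Fin n →₀ ℕ)) :
    ∃ p : MvPolynomial (Fin n × Fin n) K, ∀ g : Matrix.GeneralLinearGroup (Fin n) K,
      IsCoordBasis (V.map (coordChange g).toLinearMap) B ↔ eval (entries g) p ≠ 0 := by
  classical
  by_cases hcard : B.card = Module.finrank K V
  swap
  · refine ⟨0, fun g => ?_⟩
    rw [map_zero]
    exact iff_of_false (fun h => hcard (h.1.trans (finrank_map_coordChange g V))) fun h => h rfl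
  let bs : Module.Basis B K V := (Module.finBasisOfFinrankEq K V hcard.symm).reindex B.equivFin.symm
  let M : Matrix B B (MvPolynomial (Fin n × Fin n) K) :=
    fun i b => (genericChange K n (bs i)).coeff b
  refine ⟨M.det, fun g => ?_⟩
  rw [RingHom.map_det, ne_eq, ← Matrix.exists_vecMul_eq_zero_iff]
  have hentry : ∀ i b : B, (eval (entries g)).mapMatrix M i b = (coordChange g (bs i)).coeff b := by
    intro i b
    rw [← map_eval_genericChange, coeff_map]
    rfl
  have hmul : ∀ (t : B → K) (b : B), Matrix.vecMul t ((eval (entries g)).mapMatrix M) b =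
      (coordChange g (∑ i, t i • bs i : V)).coeff b := by
    intro t b
    simp only [Matrix.vecMul, dotProduct, hentry, Submodule.coe_sum, Submodule.coe_smul, map_sum,
      map_smul, coeff_sum, coeff_smul, smul_eq_mul]
  constructor
  · rintro h ⟨t, ht, h0⟩
    have hz := h.2 (coordChange g (∑ i, t i • bs i : V)) ⟨_, Subtype.coe_prop _, rfl⟩
      fun b hb => by rw [← hmul t ⟨b, hb⟩, h0]; rfl
    have hz' := Subtype.ext (coordChange_injective g (hz.trans (map_zero _).symm) :
      ((∑ i, t i • bs i : V) : MvPolynomial (Fin n) K) = ((0 : V) : MvPolynomial (Fin n) K))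
    exact ht (funext (Fintype.linearIndependent_iff.1 bs.linearIndependent t hz'))
  · intro h
    refine ⟨hcard.trans (finrank_map_coordChange g V).symm, ?_⟩
    rintro _ ⟨v, hv, rfl⟩ h0
    by_contra hne
    refine h ⟨bs.repr ⟨v, hv⟩, fun hr => hne ?_, ?_⟩
    · have : (⟨v, hv⟩ : V) = 0 := bs.repr.map_eq_zero_iff.1 (DFunLike.coe_injective hr)
      have hv0 : v = 0 := congrArg Subtype.val this
      rw [hv0, map_zero]
    · funext b
      rw [hmul, bs.sum_repr]
      exact h0 b b.2

end CoordinateChange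

/-! ### Constancy of the fan on an open set -/

section GenericFan

variable {K : Type*} [Field K] {n : ℕ}

/-- Over an infinite field, finitely many polynomials in the matrix entries have a common non-empty
open set of invertible matrices on which each of them vanishes only if it is zero. -/
lemma exists_generic_polynomial [Infinite K] {ι : Type*} (s : Finset ι)
    (p : ι → MvPolynomial (Fin n × Fin n) K) :
    ∃ q : MvPolynomial (Fin n × Fin n) K,
      (∃ g : Matrix.GeneralLinearGroup (Fin n) K, eval (entries g) q ≠ 0) ∧
      ∀ g : Matrix.GeneralLinearGroup (Fin n) K, eval (entries g) q ≠ 0 →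
        ∀ i ∈ s, eval (entries g) (p i) ≠ 0 ↔ p i ≠ 0 := by
  classical
  let q : MvPolynomial (Fin n × Fin n) K := ∏ i ∈ s.filter fun i => p i ≠ 0, p i
  -- Including the determinant makes the non-vanishing point found below an invertible matrix.
  let δ : MvPolynomial (Fin n × Fin n) K := (Matrix.of fun i j => X (i, j)).det
  have heval : ∀ x, eval x δ = (Matrix.of fun i j => x (i, j)).det := by
    intro x
    rw [RingHom.map_det]
    congr 1
    ext i j
    simp
  have hδ : δ ≠ 0 := by
    intro h
    have := heval (entries 1)
    rw [h, map_zero] at this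
    have h1 : (Matrix.of fun i j => entries (1 : Matrix.GeneralLinearGroup (Fin n) K) (i, j)) =
        (1 : Matrix (Fin n) (Fin n) K) := rfl
    rw [h1, Matrix.det_one] at this
    exact zero_ne_one this
  have hq : q ≠ 0 := Finset.prod_ne_zero_iff.2 fun i hi => (Finset.mem_filter.1 hi).2
  refine ⟨q, ?_, fun g hg i hi => ⟨fun h h0 => h (by rw [h0, map_zero]), fun h => ?_⟩⟩
  · obtain ⟨x, hx⟩ : ∃ x, eval x (q * δ) ≠ 0 := by
      by_contra! h
      exact mul_ne_zero hq hδ (MvPolynomial.funext fun x => by rw [h, map_zero])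
    rw [map_mul] at hx
    obtain ⟨hxq, hxδ⟩ := mul_ne_zero_iff.1 hx
    rw [heval] at hxδ
    exact ⟨Matrix.GeneralLinearGroup.mkOfDetNeZero _ hxδ, hxq⟩
  · rw [map_prod] at hg
    exact Finset.prod_ne_zero_iff.1 hg i (Finset.mem_filter.2 ⟨hi, h⟩)

lemma IsCoordBasis.degree_eq_of_le_homogeneousSubmodule {V : Submodule K (MvPolynomial (Fin n) K)}
    {d : ℕ} (hV : V ≤ homogeneousSubmodule (Fin n) K d) {B : Finset (Fin n →₀ ℕ)}
    (hB : IsCoordBasis V B) : ∀ b ∈ B, b.degree = d := by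
  intro b hb
  have := finiteDimensional_of_le_homogeneousSubmodule hV
  obtain ⟨v, hv, hdual⟩ := hB.exists_dual b
  exact degree_eq_of_mem_support (hV hv) (by simp [hdual b hb])

lemma isZariskiOpen_eval_ne_zero (q : MvPolynomial (Fin n × Fin n) K) :
    IsZariskiOpen {g : Matrix.GeneralLinearGroup (Fin n) K | eval (entries g) q ≠ 0} :=
  ⟨{q}, by simp only [Set.mem_singleton_iff, exists_eq_left]; rfl⟩

lemma groebnerFan_eq_of_initialIdeal_eq_iff {I J : Ideal (MvPolynomial (Fin n) K)}
    (h : ∀ ω ω', initialIdeal ω I = initialIdeal ω' I ↔ initialIdeal ω J = initialIdeal ω' J) :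
    groebnerFan I = groebnerFan J := by
  have : weightClass I = weightClass J := by
    funext ω
    ext ω'
    exact h ω' ω
  rw [groebnerFan, groebnerFan, this]

lemma exists_polynomial_groebnerFan_eq [Infinite K] {I : Ideal (MvPolynomial (Fin n) K)}
    (hI : ∀ f ∈ I, ∀ d, homogeneousComponent d f ∈ I) :
    ∃ q : MvPolynomial (Fin n × Fin n) K,
      (∃ g : Matrix.GeneralLinearGroup (Fin n) K, eval (entries g) q ≠ 0) ∧
      ∀ g h : Matrix.GeneralLinearGroup (Fin n) K, eval (entries g) q ≠ 0 →
        eval (entries h) q ≠ 0 → groebnerFan (transform g I) = groebnerFan (transform h I) := by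
  classical
  obtain ⟨D, hD⟩ := exists_degree_initialIdeal_eq_iff K n
    fun d => Module.finrank K (homogeneousPiece I d)
  have hfd := fun d => finiteDimensional_of_le_homogeneousSubmodule (homogeneousPiece_le I d)
  choose p hp using fun (x : ℕ × Finset (Fin n →₀ ℕ)) =>
    exists_polynomial_isCoordBasis (V := homogeneousPiece I x.1) x.2
  have hfin : {a : Fin n →₀ ℕ | a.degree ≤ D}.Finite := Finsupp.finite_of_degree_le D
  obtain ⟨q, hq, hgen⟩ :=
    exists_generic_polynomial (Finset.range (D + 1) ×ˢ hfin.toFinset.powerset) p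
  refine ⟨q, hq, fun g h hg hh => groebnerFan_eq_of_initialIdeal_eq_iff fun ω ω' => ?_⟩
  have hfinrank : ∀ (k : Matrix.GeneralLinearGroup (Fin n) K) d,
      Module.finrank K (homogeneousPiece (transform k I) d) =
        Module.finrank K (homogeneousPiece I d) := fun k d => by
    rw [homogeneousPiece_transform]
    exact finrank_map_coordChange k _
  have hbasis : ∀ d ≤ D, ∀ B, IsCoordBasis (homogeneousPiece (transform g I) d) B ↔
      IsCoordBasis (homogeneousPiece (transform h I) d) B := by
    intro d hd B
    by_cases hB : B ⊆ hfin.toFinset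
    · have hmem : (d, B) ∈ Finset.range (D + 1) ×ˢ hfin.toFinset.powerset :=
        Finset.mem_product.2 ⟨Finset.mem_range.2 (by omega), Finset.mem_powerset.2 hB⟩
      rw [homogeneousPiece_transform, homogeneousPiece_transform, hp (d, B) g, hp (d, B) h,
        hgen g hg _ hmem, hgen h hh _ hmem]
    -- Bases in degree `d ≤ D` consist of exponents of degree `d`, so only finitely many sets had to
    -- be made generic.
    · have hnot : ∀ k, ¬ IsCoordBasis (homogeneousPiece (transform k I) d) B := fun k hk =>
        hB fun b hb => hfin.mem_toFinset.2
          ((hk.degree_eq_of_le_homogeneousSubmodule (homogeneousPiece_le _ d) b hb).trans_le hd)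
      exact iff_of_false (hnot g) (hnot h)
  rw [hD _ (homogeneousComponent_mem_transform hI) (hfinrank g),
    hD _ (homogeneousComponent_mem_transform hI) (hfinrank h)]
  refine forall₂_congr fun d hd => ?_
  rw [initialSubspace_eq_iff (homogeneousPiece_le _ d),
    initialSubspace_eq_iff (homogeneousPiece_le _ d)]
  simp only [hbasis d hd]

end GenericFan

end GrobnerFan

/-! ### The theorem, over finite and infinite fields -/

theorem corollary2p12 {K : Type*} [Field K] (n : ℕ) (I : Ideal (MvPolynomial (Fin n) K))
    (hI : I.IsHomogeneous (MvPolynomial.homogeneousSubmodule (Fin n) K)) :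
    ∃ U : Set (Matrix.GeneralLinearGroup (Fin n) K),
      GrobnerFan.IsZariskiOpen U ∧ U.Nonempty ∧
        ∀ g ∈ U, ∀ h ∈ U,
          GrobnerFan.groebnerFan (GrobnerFan.transform g I) =
            GrobnerFan.groebnerFan (GrobnerFan.transform h I) := by
  classical
  rcases finite_or_infinite K with hK | hK
  · -- The Zariski topology on the points of `GL_n` is discrete over a finite field.
    have := Fintype.ofFinite K
    have hone : ∀ g : Matrix.GeneralLinearGroup (Fin n) K, MvPolynomial.eval (GrobnerFan.entries g)
        (MvPolynomial.indicator (GrobnerFan.entries 1)) ≠ 0 → g = 1 := by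
      intro g hg
      by_contra hne
      refine hg (MvPolynomial.eval_indicator_apply_eq_zero _ _ fun h => hne ?_)
      ext i j
      exact congrFun h (i, j)
    refine ⟨_, GrobnerFan.isZariskiOpen_eval_ne_zero
      (MvPolynomial.indicator (GrobnerFan.entries 1)), ⟨1, ?_⟩, fun g hg h hh => ?_⟩
    · change MvPolynomial.eval _ _ ≠ 0
      rw [MvPolynomial.eval_indicator_apply_eq_one]
      exact one_ne_zero
    · rw [hone g hg, hone h hh]
  · obtain ⟨q, hq, hfan⟩ := GrobnerFan.exists_polynomial_groebnerFan_eq (I := I)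
      fun f hf d => MvPolynomial.homogeneousComponent_mem_of_mem hI hf d
    exact ⟨_, GrobnerFan.isZariskiOpen_eval_ne_zero q, hq, fun g hg h hh => hfan g h hg hh⟩
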